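/- Let $G=(G(x))_{x\in\mathbb R}$ be a real-valued centered stationary Gaussian random field on a probability space $(\Omega,\mathbb P)$ with covariance function $\mathcal C$, that is, $\mathbb E[G(x)]=0$ and $\mathbb E[G(x)G(y)]=\mathcal C(x-y)$ for all $x,y\in\mathbb R$. Assume that $\mathcal C$ is Hölder continuous at $0$ (there are $\alpha>0$ and $K$ with $|\mathcal C(x)-\mathcal C(0)|\le K|x|^\alpha$ for all $x$ near $0$) and that, for some $\beta>0$ and some constant $K'$, $|\mathcal C(x)|\le K'(1+|x|)^{-\beta}$ for all $x\in\mathbb R$. Then $G$ has a modification with almost surely continuous sample paths. Replace $G$ by any such modification, set $a(x)=\exp(G(x))$, and let $f\in C^1([0,1])$. Then the following hold. (i) The effective coefficient is $\bar a:=\mathbb E\big[\tfrac1{a(x)}\big]^{-1}=\exp\big(-\tfrac{\mathcal C(0)}2\big)>0$ for every $x\in\mathbb R$, where $\tfrac1{a(x)}$ is integrable. (ii) The problem $(\bar a\,\bar u'(x))'=f'(x)$ on $(0,1)$, $\bar u(0)=\bar u(1)=0$, has a unique solution $\bar u\in C^1([0,1])$, given by $$\bar u(x)=\int_0^x\frac1{\bar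 a}f(y)\,dy-x\int_0^1\frac1{\bar a}f(y)\,dy .$$ (iii) Almost surely, for every $\varepsilon>0$ the problem $\big(a(\tfrac x\varepsilon)u_\varepsilon'(x)\big)'=f'(x)$ on $(0,1)$, $u_\varepsilon(0)=u_\varepsilon(1)=0$, has a unique solution $u_\varepsilon\in C^1([0,1])$, given by $$u_\varepsilon(x)=\int_0^x\frac{f(y)}{a(\frac y\varepsilon)}\,dy-\int_0^x\frac{dy}{a(\frac y\varepsilon)}\Big(\int_0^1\frac{dy}{a(\frac y\varepsilon)}\Big)^{-1}\int_0^1\frac{f(y)}{a(\frac y\varepsilon)}\,dy ,$$ and $\lim_{\varepsilon\downarrow0}u_\varepsilon(x)=\bar u(x)$ for every $x\in[0,1]$. -/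

import Mathlib

open MeasureTheory ProbabilityTheory Filter Topology

/-- `G'` is a modification of the random field `G` whose sample paths are almost surely
continuous on `ℝ`. -/
structure IsContinuousModification {Ω : Type*} [MeasurableSpace Ω] (G G' : ℝ → Ω → ℝ)
    (P : Measure Ω) : Prop where
  modification : ∀ x, G' x =ᵐ[P] G x
  ae_continuous : ∀ᵐ ω ∂P, Continuous fun x => G' x ω

/-- `u ∈ C¹([0,1])` solves `(A u')' = f'` on `(0,1)` with `u(0) = u(1) = 0`.
(For `A` continuous, `u ∈ C¹` and `f ∈ C¹` the flux `A u'` is continuous, so that the classical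
and the distributional readings of the equation agree.) -/
structure IsDirichletSolution (A f u : ℝ → ℝ) : Prop where
  contDiffOn : ContDiffOn ℝ 1 u (Set.Icc 0 1)
  equation : ∀ x ∈ Set.Ioo (0 : ℝ) 1, HasDerivAt (fun y => A y * deriv u y) (deriv f x) x
  left : u 0 = 0
  right : u 1 = 0

/-- `u` is the unique solution on `[0,1]` of the Dirichlet problem. -/
def IsUniqueDirichletSolution (A f u : ℝ → ℝ) : Prop :=
  IsDirichletSolution A f u ∧ ∀ v, IsDirichletSolution A f v → Set.EqOn v u (Set.Icc 0 1)

/-- The log-normal coefficient field `a = exp G`. -/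
noncomputable def logNormal {Ω : Type*} (G : ℝ → Ω → ℝ) (x : ℝ) (ω : Ω) : ℝ :=
  Real.exp (G x ω)

/-- The explicit solution for the coefficient `x ↦ a (x / ε)`. -/
noncomputable def uEps (a f : ℝ → ℝ) (ε x : ℝ) : ℝ :=
  (∫ y in (0 : ℝ)..x, 1 / a (y / ε) * f y) -
    (∫ y in (0 : ℝ)..x, 1 / a (y / ε)) * (∫ y in (0 : ℝ)..1, 1 / a (y / ε))⁻¹ *
      ∫ y in (0 : ℝ)..1, 1 / a (y / ε) * f y

/-- The explicit solution for the constant coefficient `abar`. -/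
noncomputable def uBar (abar : ℝ) (f : ℝ → ℝ) (x : ℝ) : ℝ :=
  (∫ y in (0 : ℝ)..x, 1 / abar * f y) - x * ∫ y in (0 : ℝ)..1, 1 / abar * f y

/-- The effective coefficient `exp (-C(0)/2)`. -/
noncomputable def aBar (C : ℝ → ℝ) : ℝ := Real.exp (-(C 0 / 2))

/-! In one dimension the equation says that `a u' - f` is constant, and the boundary conditions fix
the constant. This gives the explicit formulas and uniqueness, and reduces homogenization to
integrals of `1 / a (y / ε)`, alone or against `f`. If the averages of `1 / a` over `[0, R]` tend to
`1 / m`, rescaling handles the first kind and integration by parts against the `C¹` function `f` the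
second (`tendsto_uEps`).

The probabilistic core is thus a law of large numbers for `exp (-G)`, proved by second moments. Its
covariance is `exp (C 0) * (exp (C (x - y)) - 1)`, which inherits the polynomial decay of `C`, so
the variance of the average over `[0, R]` decays polynomially in `R`. Along `R = n ^ k` with `k`
large these variances are summable, whence almost sure convergence; since `exp (-G)` is positive,
its integrals are monotone in `R` and the gaps between powers are filled
(`ae_tendsto_integral_div`).

Continuity of paths is Kolmogorov's criterion: Gaussian moments of order `2p` are powers of the
increment variance `2 (C 0 - C (x - y))`, which is of Hölder order `α`, so a large `p` gives any
exponent required. -/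

/-! ### The one-dimensional Dirichlet problem -/

/-- A function with vanishing derivative on `(0,1)` is constant on `(0,1)`. -/
lemma eq_of_hasDerivAt_zero_Ioo {φ : ℝ → ℝ} (h : ∀ x ∈ Set.Ioo (0 : ℝ) 1, HasDerivAt φ 0 x)
    {x y : ℝ} (hx : x ∈ Set.Ioo (0 : ℝ) 1) (hy : y ∈ Set.Ioo (0 : ℝ) 1) : φ x = φ y :=
  isOpen_Ioo.is_const_of_deriv_eq_zero isPreconnected_Ioo
    (fun z hz => (h z hz).differentiableAt.differentiableWithinAt)
    (fun z hz => (h z hz).deriv) hx hy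

/-- Uniqueness for the Dirichlet problem with positive coefficient. -/
lemma IsDirichletSolution.eqOn {A f v w : ℝ → ℝ} (hA : ∀ x, 0 < A x)
    (hv : IsDirichletSolution A f v) (hw : IsDirichletSolution A f w) :
    Set.EqOn v w (Set.Icc 0 1) := by
  have hdiff : ∀ {u : ℝ → ℝ}, IsDirichletSolution A f u →
      ∀ x ∈ Set.Ioo (0 : ℝ) 1, HasDerivAt u (deriv u x) x := fun hu x hx =>
    ((hu.contDiffOn.differentiableOn one_ne_zero).differentiableAt
      (Icc_mem_nhds hx.1 hx.2)).hasDerivAt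
  set φ : ℝ → ℝ := fun y => A y * deriv v y - A y * deriv w y with hφ
  have hconst : ∀ x ∈ Set.Ioo (0 : ℝ) 1, HasDerivAt φ 0 x := fun x hx => by
    have h := (hv.equation x hx).sub (hw.equation x hx)
    rw [sub_self] at h
    exact h
  have hcont : ContinuousOn (fun x => v x - w x) (Set.Icc 0 1) :=
    hv.contDiffOn.continuousOn.sub hw.contDiffOn.continuousOn
  have hder : ∀ x ∈ Set.Ioo (0 : ℝ) 1,
      HasDerivAt (fun x => v x - w x) (deriv v x - deriv w x) x := fun x hx =>
    (hdiff hv x hx).sub (hdiff hw x hx)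
  -- Rolle: `v - w` vanishes at both ends, so the constant flux difference `φ` is zero at some
  -- point, hence everywhere.
  obtain ⟨c, hc, hc'⟩ := exists_hasDerivAt_eq_slope _ _ zero_lt_one hcont hder
  have hφc : φ c = 0 := by
    have : deriv v c - deriv w c = 0 := by
      rw [hc']; simp [hv.left, hv.right, hw.left, hw.right]
    rw [hφ]; simp only; rw [← mul_sub, this, mul_zero]
  have hzero : ∀ x ∈ Set.Ioo (0 : ℝ) 1, deriv v x - deriv w x = 0 := fun x hx => by
    have h1 : φ x = 0 := (eq_of_hasDerivAt_zero_Ioo hconst hx hc).trans hφc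
    have h2 : A x * (deriv v x - deriv w x) = 0 := by rw [mul_sub]; exact h1
    exact (mul_eq_zero.1 h2).resolve_left (hA x).ne'
  intro x hx
  rcases hx.1.eq_or_lt with rfl | hx0
  · rw [hv.left, hw.left]
  obtain ⟨d, hd, hd'⟩ := exists_hasDerivAt_eq_slope _ _ hx0
    (hcont.mono (Set.Icc_subset_Icc_right hx.2))
    (fun y hy => hder y ⟨hy.1, hy.2.trans_le hx.2⟩)
  rw [hzero d ⟨hd.1, hd.2.trans_le hx.2⟩, hv.left, hw.left] at hd'
  have := (div_eq_zero_iff.1 hd'.symm).resolve_right (by linarith)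
  linarith

/-- For a continuous positive coefficient the explicit formula solves the Dirichlet problem. -/
lemma isDirichletSolution_uEps {a f : ℝ → ℝ} (ha : Continuous a) (hpos : ∀ x, 0 < a x)
    (hf : ContDiffOn ℝ 1 f (Set.Icc 0 1)) (ε : ℝ) :
    IsDirichletSolution (fun x => a (x / ε)) f (uEps a f ε) := by
  set b : ℝ → ℝ := fun y => 1 / a (y / ε) with hb
  have hbc : Continuous b := by
    rw [hb]; exact continuous_const.div (by fun_prop) fun x => (hpos _).ne'
  have hbpos : ∀ x, 0 < b x := fun x => one_div_pos.2 (hpos _)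
  -- `f` is controlled only on `[0,1]`. Its extension by endpoint values is continuous on the line,
  -- so the primitive `U` below is `C¹` across the endpoints.
  set g : ℝ → ℝ := Set.IccExtend (zero_le_one' ℝ) ((Set.Icc (0 : ℝ) 1).domRestrict f) with hg
  have hgc : Continuous g := (hf.continuousOn.domRestrict).Icc_extend'
  have hgf : ∀ x ∈ Set.Icc (0 : ℝ) 1, g x = f x := fun x hx => by
    rw [hg, Set.IccExtend_of_mem _ _ hx]; rfl
  -- The integration constant forced by the right boundary condition; the flux is then `f - c`.
  set c : ℝ := (∫ y in (0 : ℝ)..1, b y)⁻¹ * ∫ y in (0 : ℝ)..1, b y * f y with hc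
  set w : ℝ → ℝ := fun y => b y * (g y - c) with hw
  have hwc : Continuous w := by rw [hw]; fun_prop
  set U : ℝ → ℝ := fun x => ∫ y in (0 : ℝ)..x, w y with hU
  have hUd : ∀ x, HasDerivAt U (w x) x := fun x =>
    intervalIntegral.integral_hasDerivAt_right (hwc.intervalIntegrable _ _)
      hwc.stronglyMeasurable.stronglyMeasurableAtFilter hwc.continuousAt
  have hUeq : ∀ x ∈ Set.Icc (0 : ℝ) 1, uEps a f ε x = U x := fun x hx => by
    have h1 : ∫ y in (0 : ℝ)..x, b y * f y = ∫ y in (0 : ℝ)..x, b y * g y := by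
      refine intervalIntegral.integral_congr fun y hy => ?_
      rw [Set.uIcc_of_le hx.1] at hy
      simp only [hgf y ⟨hy.1, hy.2.trans hx.2⟩]
    have h2 : U x = (∫ y in (0 : ℝ)..x, b y * g y) - ∫ y in (0 : ℝ)..x, b y * c := by
      have hbg : Continuous fun y => b y * g y := hbc.mul hgc
      have hbc' : Continuous fun y => b y * c := hbc.mul continuous_const
      rw [← intervalIntegral.integral_sub (hbg.intervalIntegrable _ _)
        (hbc'.intervalIntegrable _ _)]
      simp only [hU, hw, mul_sub]
    rw [h2, ← h1, intervalIntegral.integral_mul_const, hc, ← mul_assoc]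
    rfl
  have hI : (∫ y in (0 : ℝ)..1, b y) ≠ 0 :=
    (intervalIntegral.intervalIntegral_pos_of_pos (hbc.intervalIntegrable _ _) hbpos
      zero_lt_one).ne'
  refine ⟨?_, fun x hx => ?_, ?_, ?_⟩
  · refine ContDiffOn.congr ?_ hUeq
    refine ContDiff.contDiffOn (contDiff_one_iff_deriv.2 ⟨fun x => (hUd x).differentiableAt, ?_⟩)
    rwa [show deriv U = w from funext fun x => (hUd x).deriv]
  · have hfd : HasDerivAt f (deriv f x) x :=
      ((hf.differentiableOn one_ne_zero).differentiableAt
        (Icc_mem_nhds hx.1 hx.2)).hasDerivAt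
    refine (hfd.sub_const c).congr_of_eventuallyEq ?_
    filter_upwards [Ioo_mem_nhds hx.1 hx.2] with y hy
    have : deriv (uEps a f ε) y = w y := by
      rw [← (hUd y).deriv]
      refine Filter.EventuallyEq.deriv_eq ?_
      filter_upwards [Icc_mem_nhds hy.1 hy.2] with z hz using hUeq z hz
    rw [this, hw, hb]
    simp only
    rw [hgf y (Set.Ioo_subset_Icc_self hy)]
    have := (hpos (y / ε)).ne'
    field_simp
  · simp [uEps]
  · change (∫ y in (0 : ℝ)..1, b y * f y) - (∫ y in (0 : ℝ)..1, b y) *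
      (∫ y in (0 : ℝ)..1, b y)⁻¹ * (∫ y in (0 : ℝ)..1, b y * f y) = 0
    rw [mul_inv_cancel₀ hI]; ring

/-- For a continuous positive coefficient the explicit formula is the unique solution. -/
lemma isUniqueDirichletSolution_uEps {a f : ℝ → ℝ} (ha : Continuous a) (hpos : ∀ x, 0 < a x)
    (hf : ContDiffOn ℝ 1 f (Set.Icc 0 1)) (ε : ℝ) :
    IsUniqueDirichletSolution (fun x => a (x / ε)) f (uEps a f ε) :=
  ⟨isDirichletSolution_uEps ha hpos hf ε,
    fun _ hv => hv.eqOn (fun _ => hpos _) (isDirichletSolution_uEps ha hpos hf ε)⟩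

/-- Makes the effective problem a special case of the oscillating one. -/
lemma uEps_const {m : ℝ} (hm : 0 < m) (f : ℝ → ℝ) (ε : ℝ) : uEps (fun _ => m) f ε = uBar m f := by
  funext x
  simp only [uEps, uBar, intervalIntegral.integral_const, smul_eq_mul]
  have := hm.ne'
  field_simp
  simp

/-! ### From powers to all lengths -/

/-- If `A` is nonnegative and monotone on `[0,∞)` and `A (n ^ k) / n ^ k → m`, then
`A R / R → m`. -/
lemma tendsto_div_atTop_of_tendsto_pow {A : ℝ → ℝ} {m : ℝ} {k : ℕ} (hk : k ≠ 0)
    (hmono : MonotoneOn A (Set.Ici 0)) (hnonneg : ∀ R, 0 ≤ R → 0 ≤ A R)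
    (h : Tendsto (fun n : ℕ => A ((n : ℝ) ^ k) / (n : ℝ) ^ k) atTop (𝓝 m)) :
    Tendsto (fun R => A R / R) atTop (𝓝 m) := by
  -- With `r` the integer part of the `k`-th root, `r ^ k ≤ R ≤ (r + 1) ^ k`. Monotonicity brackets
  -- `A R / R`, up to factors `(r / (r + 1)) ^ k` and its inverse, which tend to `1`.
  set r : ℝ → ℕ := fun R => ⌊R ^ ((k : ℝ)⁻¹)⌋₊ with hr
  have hkpos : (0 : ℝ) < (k : ℝ)⁻¹ := by positivity
  have hrtop : Tendsto r atTop atTop :=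
    tendsto_nat_floor_atTop.comp (tendsto_rpow_atTop hkpos)
  have hratio : Tendsto (fun n : ℕ => ((n : ℝ) / ((n : ℝ) + 1)) ^ k) atTop (𝓝 1) := by
    simpa using (tendsto_natCast_div_add_atTop (1 : ℝ)).pow k
  have hlow : Tendsto (fun n : ℕ => A ((n : ℝ) ^ k) / (n : ℝ) ^ k * ((n : ℝ) / ((n : ℝ) + 1)) ^ k)
      atTop (𝓝 m) := by simpa using h.mul hratio
  have hup : Tendsto (fun n : ℕ => A (((n + 1 : ℕ) : ℝ) ^ k) / ((n + 1 : ℕ) : ℝ) ^ k *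
      (((n : ℝ) / ((n : ℝ) + 1)) ^ k)⁻¹) atTop (𝓝 m) := by
    simpa using (h.comp (tendsto_add_atTop_nat 1)).mul (hratio.inv₀ one_ne_zero)
  refine tendsto_of_tendsto_of_tendsto_of_le_of_le' (hlow.comp hrtop) (hup.comp hrtop) ?_ ?_
  all_goals
    filter_upwards [eventually_ge_atTop 1] with R hR
    have hR0 : (0 : ℝ) ≤ R := by linarith
    have hpow : (R ^ ((k : ℝ)⁻¹)) ^ k = R := Real.rpow_inv_natCast_pow hR0 hk
    have hroot : (1 : ℝ) ≤ R ^ ((k : ℝ)⁻¹) := Real.one_le_rpow hR hkpos.le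
    have hn1 : 1 ≤ r R := Nat.le_floor (by simpa using hroot)
    have hn0 : (0 : ℝ) < r R := by exact_mod_cast hn1
    have hle : (r R : ℝ) ^ k ≤ R := by
      calc (r R : ℝ) ^ k ≤ (R ^ ((k : ℝ)⁻¹)) ^ k := by
            gcongr; exact Nat.floor_le (by linarith)
        _ = R := hpow
    have hge : R ≤ ((r R : ℝ) + 1) ^ k := by
      calc R = (R ^ ((k : ℝ)⁻¹)) ^ k := hpow.symm
        _ ≤ _ := by gcongr; exact (Nat.lt_floor_add_one _).le
    simp only [Function.comp]
  · have h1 : A ((r R : ℝ) ^ k) ≤ A R := hmono (Set.mem_Ici.2 (by positivity)) hR0 hle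
    calc A ((r R : ℝ) ^ k) / (r R : ℝ) ^ k * ((r R : ℝ) / ((r R : ℝ) + 1)) ^ k
        = A ((r R : ℝ) ^ k) / ((r R : ℝ) + 1) ^ k := by
          rw [div_pow]; field_simp
      _ ≤ A R / R := div_le_div₀ (hnonneg R hR0) h1 (by linarith) hge
  · push_cast
    have h1 : A R ≤ A (((r R : ℝ) + 1) ^ k) := hmono hR0 (by simp; positivity) hge
    calc A R / R ≤ A (((r R : ℝ) + 1) ^ k) / (r R : ℝ) ^ k :=
          div_le_div₀ (hnonneg _ (by positivity)) h1 (by positivity) hle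
      _ = _ := by rw [div_pow]; field_simp

/-! ### Weak convergence of oscillating coefficients -/

section Oscillating

variable {b : ℝ → ℝ} {m : ℝ}

/-- Spatial averages of the rescaled coefficient converge to the mean. -/
lemma tendsto_integral_comp_div (h : Tendsto (fun R => (∫ y in (0 : ℝ)..R, b y) / R) atTop (𝓝 m))
    {x : ℝ} (hx : 0 ≤ x) :
    Tendsto (fun ε => ∫ y in (0 : ℝ)..x, b (y / ε)) (𝓝[>] 0) (𝓝 (x * m)) := by
  rcases hx.eq_or_lt with rfl | hx
  · simp
  have h1 : Tendsto (fun ε : ℝ => x / ε) (𝓝[>] 0) atTop := by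
    simpa [div_eq_mul_inv] using tendsto_inv_nhdsGT_zero.const_mul_atTop hx
  refine ((h.comp h1).const_mul x).congr' ?_
  filter_upwards [self_mem_nhdsWithin] with ε hε
  have hε : (0 : ℝ) < ε := hε
  rw [intervalIntegral.integral_comp_div _ hε.ne']
  simp only [Function.comp, zero_div, smul_eq_mul]
  field_simp

/-- Rescaled coefficients converge weakly to the mean, tested against `C¹` functions. -/
lemma tendsto_integral_comp_div_mul (hb : Continuous b) (hb0 : ∀ x, 0 ≤ b x)
    (h : Tendsto (fun R => (∫ y in (0 : ℝ)..R, b y) / R) atTop (𝓝 m))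
    {f : ℝ → ℝ} (hf : ContDiffOn ℝ 1 f (Set.Icc 0 1)) {x : ℝ} (hx : x ∈ Set.Icc (0 : ℝ) 1) :
    Tendsto (fun ε => ∫ y in (0 : ℝ)..x, b (y / ε) * f y) (𝓝[>] 0)
      (𝓝 (∫ y in (0 : ℝ)..x, m * f y)) := by
  set f' : ℝ → ℝ := derivWithin f (Set.Icc 0 1) with hf'
  have hsub : Set.uIcc 0 x ⊆ Set.Icc (0 : ℝ) 1 := by
    rw [Set.uIcc_of_le hx.1]; exact Set.Icc_subset_Icc_right hx.2
  have hf'c : ContinuousOn f' (Set.Icc 0 1) :=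
    hf.continuousOn_derivWithin (uniqueDiffOn_Icc zero_lt_one) le_rfl
  have hf'i : IntervalIntegrable f' volume 0 x := (hf'c.mono hsub).intervalIntegrable
  -- Integration by parts moves the oscillation into the primitive `v`, which converges pointwise,
  -- while `f'` stays fixed.
  have parts : ∀ {v v' : ℝ → ℝ}, (∀ y, HasDerivAt v (v' y) y) → Continuous v' → v 0 = 0 →
      ∫ y in (0 : ℝ)..x, v' y * f y = f x * v x - ∫ y in (0 : ℝ)..x, f' y * v y := by
    intro v v' hv hv' h0
    have := intervalIntegral.integral_mul_deriv_eq_deriv_mul_of_hasDerivAt (a := 0) (b := x)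
      (u := f) (v := v) (u' := f') (v' := v') (hf.continuousOn.mono hsub)
      (fun y _ => (hv y).continuousAt.continuousWithinAt)
      (fun y hy => by
        rw [min_eq_left hx.1, max_eq_right hx.1] at hy
        have hn : Set.Icc (0 : ℝ) 1 ∈ 𝓝 y := Icc_mem_nhds hy.1 (hy.2.trans_le hx.2)
        rw [hf', derivWithin_of_mem_nhds hn]
        exact ((hf.differentiableOn one_ne_zero).differentiableAt hn).hasDerivAt)
      (fun y _ => hv y) hf'i (hv'.intervalIntegrable _ _)
    rw [h0, mul_zero, sub_zero] at this
    rw [← this]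
    simp only [mul_comm]
  have hbε : ∀ ε : ℝ, Continuous fun y => b (y / ε) := fun ε => by fun_prop
  set F : ℝ → ℝ → ℝ := fun ε y => ∫ z in (0 : ℝ)..y, b (z / ε) with hF
  have hFd : ∀ ε y, HasDerivAt (F ε) (b (y / ε)) y := fun ε y =>
    intervalIntegral.integral_hasDerivAt_right ((hbε ε).intervalIntegrable _ _)
      (hbε ε).stronglyMeasurable.stronglyMeasurableAtFilter (hbε ε).continuousAt
  rw [parts (v := fun y => y * m) (v' := fun _ => m)
    (fun y => by simpa using (hasDerivAt_id y).mul_const m) continuous_const (by simp)]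
  refine Tendsto.congr (fun ε => (parts (hFd ε) (hbε ε) (by simp [hF])).symm) ?_
  refine ((tendsto_integral_comp_div h hx.1).const_mul _).sub ?_
  obtain ⟨M, hM⟩ := isCompact_Icc.exists_bound_of_continuousOn hf'c
  refine intervalIntegral.tendsto_integral_filter_of_dominated_convergence
    -- `M` bounds `f'`. The primitive `F ε` is nonnegative and increasing, so it is at most `F ε 1`,
    -- which is eventually below `m + 1`.
    (fun _ => M * (m + 1)) ?_ ?_ intervalIntegrable_const ?_
  · refine Eventually.of_forall fun ε => ?_
    have hFc : Continuous (F ε) := continuous_iff_continuousAt.2 fun y => (hFd ε y).continuousAt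
    have := (hf'i.mul_continuousOn hFc.continuousOn).aestronglyMeasurable
    rwa [Set.uIoc_of_le hx.1]
  · have h1 : ∀ᶠ ε in 𝓝[>] (0 : ℝ), F ε 1 < m + 1 := by
      have := tendsto_integral_comp_div h zero_le_one
      rw [one_mul] at this
      exact this.eventually_lt_const (by linarith)
    filter_upwards [h1] with ε hε
    refine Eventually.of_forall fun y hy => ?_
    rw [Set.uIoc_of_le hx.1] at hy
    have hy1 : y ≤ 1 := hy.2.trans hx.2
    have h2 : 0 ≤ F ε y := intervalIntegral.integral_nonneg hy.1.le fun z _ => hb0 _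
    have h3 : F ε y ≤ F ε 1 :=
      intervalIntegral.integral_mono_interval le_rfl hy.1.le hy1
        (Eventually.of_forall fun z => hb0 _) ((hbε ε).intervalIntegrable _ _)
    rw [norm_mul, Real.norm_of_nonneg h2]
    have h4 := hM y ⟨hy.1.le, hy1⟩
    exact mul_le_mul h4 (by linarith) h2 ((norm_nonneg _).trans h4)
  · refine Eventually.of_forall fun y hy => ?_
    rw [Set.uIoc_of_le hx.1] at hy
    exact (tendsto_integral_comp_div h hy.1.le).const_mul _

end Oscillating

/-- Homogenization of a deterministic coefficient whose inverse has asymptotic mean `1 / m`. -/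
lemma tendsto_uEps {a : ℝ → ℝ} {m : ℝ} (ha : Continuous a) (hpos : ∀ x, 0 < a x) (hm : 0 < m)
    (h : Tendsto (fun R => (∫ y in (0 : ℝ)..R, 1 / a y) / R) atTop (𝓝 (1 / m)))
    {f : ℝ → ℝ} (hf : ContDiffOn ℝ 1 f (Set.Icc 0 1)) {x : ℝ} (hx : x ∈ Set.Icc (0 : ℝ) 1) :
    Tendsto (fun ε => uEps a f ε x) (𝓝[>] 0) (𝓝 (uBar m f x)) := by
  have hb : Continuous fun x => 1 / a x := continuous_const.div ha fun x => (hpos x).ne'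
  have hb0 : ∀ x, 0 ≤ 1 / a x := fun x => (one_div_pos.2 (hpos x)).le
  have h1 := tendsto_integral_comp_div (b := fun x => 1 / a x) h hx.1
  have h2 := tendsto_integral_comp_div (b := fun x => 1 / a x) h zero_le_one
  have h3 := tendsto_integral_comp_div_mul hb hb0 h hf hx
  have h4 := tendsto_integral_comp_div_mul hb hb0 h hf (Set.right_mem_Icc.2 zero_le_one)
  have h5 := h3.sub ((h1.mul (h2.inv₀ (by positivity))).mul h4)
  have : uBar m f x = (∫ y in (0 : ℝ)..x, 1 / m * f y) -
      x * (1 / m) * (1 * (1 / m))⁻¹ * ∫ y in (0 : ℝ)..1, 1 / m * f y := by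
    rw [uBar]; congr 2; field_simp
  rw [this]
  exact h5

/-! ### Almost sure summability -/

section Summability

variable {Ω ι : Type*} [MeasurableSpace Ω] {P : Measure Ω} [Countable ι]

/-- A family of nonnegative random variables with summable expectations is almost surely
summable. -/
lemma ae_summable_of_lintegral_le {X : ι → Ω → ℝ} (h0 : ∀ i ω, 0 ≤ X i ω)
    (hX : ∀ i, AEMeasurable (X i) P) {b : ι → ℝ} (hb : Summable b)
    (h : ∀ i, ∫⁻ ω, ENNReal.ofReal (X i ω) ∂P ≤ ENNReal.ofReal (b i)) :
    ∀ᵐ ω ∂P, Summable fun i => X i ω := by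
  have hm : ∀ i, AEMeasurable (fun ω => ENNReal.ofReal (X i ω)) P := fun i =>
    (hX i).ennreal_ofReal
  have hfin : ∫⁻ ω, ∑' i, ENNReal.ofReal (X i ω) ∂P ≠ ⊤ := by
    rw [lintegral_tsum hm]
    exact ne_top_of_le_ne_top hb.tsum_ofReal_ne_top (ENNReal.tsum_le_tsum h)
  filter_upwards [ae_lt_top' (AEMeasurable.tsum hm) hfin] with ω hω
  simpa [ENNReal.toReal_ofReal (h0 _ ω)] using ENNReal.summable_toReal hω.ne

lemma ae_summable_of_integral_le {X : ι → Ω → ℝ} (h0 : ∀ i ω, 0 ≤ X i ω)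
    (hX : ∀ i, Integrable (X i) P) {b : ι → ℝ} (hb : Summable b)
    (h : ∀ i, ∫ ω, X i ω ∂P ≤ b i) : ∀ᵐ ω ∂P, Summable fun i => X i ω := by
  refine ae_summable_of_lintegral_le h0 (fun i => (hX i).aemeasurable) hb fun i => ?_
  rw [← ofReal_integral_eq_lintegral_ofReal (hX i) (Eventually.of_forall (h0 i))]
  exact ENNReal.ofReal_le_ofReal (h i)

end Summability

/-! ### Continuity of dyadic limits -/

lemma summable_one_div_one_add_int_sq : Summable fun k : ℤ => 1 / (1 + (k : ℝ) ^ 2) := by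
  have h : Summable fun n : ℕ => 1 / (1 + (n : ℝ) ^ 2) := by
    have h1 : Summable fun n : ℕ => 2 * (1 / ((n + 1 : ℕ) : ℝ) ^ 2) :=
      ((summable_nat_add_iff 1).2 (Real.summable_one_div_nat_pow.2 one_lt_two)).mul_left 2
    refine Summable.of_nonneg_of_le (fun n => by positivity) (fun n => ?_) h1
    push_cast
    rw [mul_one_div, div_le_div_iff₀ (by positivity) (by positivity)]
    nlinarith [sq_nonneg ((n : ℝ) - 1)]
  refine Summable.of_nat_of_neg ?_ ?_ <;> simpa using h

/-- The dyadic approximation of `x` from below at scale `2 ^ (-n)`. -/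
noncomputable def dyadicFloor (n : ℕ) (x : ℝ) : ℝ := (⌊2 ^ n * x⌋ : ℝ) / 2 ^ n

lemma abs_dyadicFloor_sub_le (n : ℕ) (x : ℝ) : |dyadicFloor n x - x| ≤ (1 / 2) ^ n := by
  have h1 := Int.floor_le (2 ^ n * x)
  have h2 := Int.lt_floor_add_one (2 ^ n * x)
  have h2n : (0 : ℝ) < 2 ^ n := by positivity
  have : dyadicFloor n x - x = (⌊2 ^ n * x⌋ - 2 ^ n * x) / 2 ^ n := by
    rw [dyadicFloor]; field_simp
  rw [this, abs_div, abs_of_pos h2n, one_div, inv_pow, ← one_div]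
  gcongr
  rw [abs_le]; constructor <;> linarith

/-- Dyadic increments `g ((k + 1) / 2 ^ n) - g (k / 2 ^ n)` that decay geometrically, locally
uniformly in space, give a continuous limit along dyadic approximations. -/
lemma exists_continuous_tendsto_dyadicFloor {g : ℝ → ℝ} {r : ℝ} (hr0 : 0 < r) (hr1 : r < 1)
    (hg : ∀ M : ℕ, ∃ H : ℝ, 0 ≤ H ∧ ∀ (n : ℕ) (k : ℤ), |(k : ℝ)| ≤ M * 2 ^ n →
      |g ((k + 1) / 2 ^ n) - g (k / 2 ^ n)| ≤ H * r ^ n) :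
    ∃ h : ℝ → ℝ, Continuous h ∧
      ∀ x, Tendsto (fun n => g (dyadicFloor n x)) atTop (𝓝 (h x)) := by
  have hfloor : ∀ (M n : ℕ) (x : ℝ), |x| ≤ M → |(⌊2 ^ n * x⌋ : ℝ)| ≤ (M + 1 : ℕ) * 2 ^ n := by
    intro M n x hx
    have h1 := Int.floor_le (2 ^ n * x)
    have h2 := Int.lt_floor_add_one (2 ^ n * x)
    have h2n : (1 : ℝ) ≤ 2 ^ n := one_le_pow₀ (by norm_num)
    have h3 := abs_le.1 hx
    push_cast
    rw [abs_le]
    constructor <;> nlinarith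
  have hstep : ∀ M : ℕ, ∃ H : ℝ, 0 ≤ H ∧ ∀ (n : ℕ) (x : ℝ), |x| ≤ M →
      dist (g (dyadicFloor n x)) (g (dyadicFloor (n + 1) x)) ≤ H * r ^ n := by
    intro M
    obtain ⟨H, hH, hk⟩ := hg (M + 1)
    refine ⟨H, hH, fun n x hx => ?_⟩
    have hHr : 0 ≤ H * r ^ n := by positivity
    have h2n : (0 : ℝ) < 2 ^ n := by positivity
    have e0 : dyadicFloor n x = ((2 * ⌊2 ^ n * x⌋ : ℤ) : ℝ) / 2 ^ (n + 1) := by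
      rw [dyadicFloor, pow_succ]; push_cast; field_simp
    -- Refining the grid either keeps the approximation or moves it one step of the finer grid, so a
    -- single dyadic increment controls the change.
    have hcase : ⌊2 ^ (n + 1) * x⌋ = 2 * ⌊2 ^ n * x⌋ ∨
        ⌊2 ^ (n + 1) * x⌋ = 2 * ⌊2 ^ n * x⌋ + 1 := by
      have h1 := Int.floor_le (2 ^ n * x)
      have h2 := Int.lt_floor_add_one (2 ^ n * x)
      have h3 : 2 * ⌊2 ^ n * x⌋ ≤ ⌊2 ^ (n + 1) * x⌋ := by
        rw [Int.le_floor, pow_succ]; push_cast; linarith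
      have h4 : ⌊2 ^ (n + 1) * x⌋ < 2 * ⌊2 ^ n * x⌋ + 2 := by
        rw [Int.floor_lt, pow_succ]; push_cast; linarith
      omega
    rcases hcase with h | h
    · rw [show dyadicFloor (n + 1) x = dyadicFloor n x by rw [e0, dyadicFloor, h], dist_self]
      exact hHr
    · have e1 : dyadicFloor (n + 1) x = (((2 * ⌊2 ^ n * x⌋ : ℤ) : ℝ) + 1) / 2 ^ (n + 1) := by
        rw [dyadicFloor, h]; push_cast; rfl
      rw [dist_comm, Real.dist_eq, e1, e0]
      refine (hk (n + 1) _ ?_).trans ?_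
      · have := hfloor M n x hx
        push_cast at this ⊢
        rw [abs_mul, abs_two, pow_succ]; linarith
      · exact mul_le_mul_of_nonneg_left (pow_le_pow_of_le_one hr0.le hr1.le n.le_succ) hH
  have hlim : ∀ x, ∃ y, Tendsto (fun n => g (dyadicFloor n x)) atTop (𝓝 y) := by
    intro x
    obtain ⟨M, hM⟩ := exists_nat_ge |x|
    obtain ⟨H, -, hH⟩ := hstep M
    exact cauchySeq_tendsto_of_complete
      (cauchySeq_of_le_geometric r H hr1 fun n => hH n x hM)
  choose h hh using hlim
  refine ⟨h, Metric.continuous_iff.2 fun x e he => ?_, hh⟩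
  obtain ⟨M, hM⟩ := exists_nat_ge (|x| + 1)
  obtain ⟨H, hH0, hH⟩ := hstep M
  obtain ⟨H', hH'0, hH'⟩ := hg (M + 1)
  have htend : Tendsto (fun n : ℕ => (2 * (H / (1 - r)) + H') * r ^ n) atTop (𝓝 0) := by
    simpa using (tendsto_pow_atTop_nhds_zero_of_lt_one hr0.le hr1).const_mul
      (2 * (H / (1 - r)) + H')
  obtain ⟨n, hn⟩ := (htend.eventually_lt_const he).exists
  have h2n : (0 : ℝ) < 2 ^ n := by positivity
  -- Below `1 / 2 ^ n` the two dyadic floors are equal or adjacent; the bound `1` keeps `y` in the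
  -- window `|y| ≤ M`.
  refine ⟨min 1 (1 / 2 ^ n), by positivity, fun y hy => ?_⟩
  have hxM : |x| ≤ M := by linarith
  have hyd : |y - x| < min 1 (1 / 2 ^ n) := by rwa [Real.dist_eq] at hy
  have hyM : |y| ≤ M := by
    have := abs_sub_abs_le_abs_sub y x
    have := hyd.trans_le (min_le_left _ _)
    linarith
  have hclose : dist (g (dyadicFloor n y)) (g (dyadicFloor n x)) ≤ H' * r ^ n := by
    have hs : |2 ^ n * y - 2 ^ n * x| < 1 := by
      rw [← mul_sub, abs_mul, abs_of_pos h2n]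
      have := hyd.trans_le (min_le_right _ _)
      rwa [lt_div_iff₀' h2n] at this
    have h1 := Int.floor_le (2 ^ n * x)
    have h2 := Int.lt_floor_add_one (2 ^ n * x)
    have h3 := Int.floor_le (2 ^ n * y)
    have h4 := Int.lt_floor_add_one (2 ^ n * y)
    obtain ⟨h5, h6⟩ := abs_lt.1 hs
    have h7 : ⌊2 ^ n * y⌋ < ⌊2 ^ n * x⌋ + 2 := by
      have : (⌊2 ^ n * y⌋ : ℝ) < ⌊2 ^ n * x⌋ + 2 := by linarith
      exact_mod_cast this
    have h8 : ⌊2 ^ n * x⌋ < ⌊2 ^ n * y⌋ + 2 := by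
      have : (⌊2 ^ n * x⌋ : ℝ) < ⌊2 ^ n * y⌋ + 2 := by linarith
      exact_mod_cast this
    have hcase : ⌊2 ^ n * y⌋ = ⌊2 ^ n * x⌋ ∨ ⌊2 ^ n * y⌋ = ⌊2 ^ n * x⌋ + 1 ∨
        ⌊2 ^ n * x⌋ = ⌊2 ^ n * y⌋ + 1 := by omega
    rcases hcase with hc | hc | hc
    · rw [dyadicFloor, dyadicFloor, hc, dist_self]; positivity
    · rw [dyadicFloor, dyadicFloor, hc, Real.dist_eq]
      push_cast
      exact hH' n _ (hfloor M n x hxM)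
    · rw [dyadicFloor, dyadicFloor, hc, dist_comm, Real.dist_eq]
      push_cast
      exact hH' n _ (hfloor M n y hyM)
  have hdx := dist_le_of_le_geometric_of_tendsto r H hr1 (fun n => hH n x hxM) (hh x) n
  have hdy := dist_le_of_le_geometric_of_tendsto r H hr1 (fun n => hH n y hyM) (hh y) n
  calc dist (h y) (h x) ≤ dist (h y) (g (dyadicFloor n y)) +
        dist (g (dyadicFloor n y)) (g (dyadicFloor n x)) + dist (g (dyadicFloor n x)) (h x) :=
        dist_triangle4 _ _ _ _
    _ ≤ H * r ^ n / (1 - r) + H' * r ^ n + H * r ^ n / (1 - r) := by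
        rw [dist_comm (h y)]; gcongr
    _ = (2 * (H / (1 - r)) + H') * r ^ n := by ring
    _ < e := hn

/-- **Kolmogorov's continuity criterion** on the real line, for even integer moments with
increments of order four. -/
lemma exists_isContinuousModification {Ω : Type*} [MeasurableSpace Ω] {P : Measure Ω}
    {G : ℝ → Ω → ℝ} {p : ℕ} (hp : p ≠ 0) {c : ℝ}
    (hint : ∀ x y, Integrable (fun ω => (G x ω - G y ω) ^ (2 * p)) P)
    (hmom : ∀ x y, |x - y| ≤ 1 → ∫ ω, (G x ω - G y ω) ^ (2 * p) ∂P ≤ c * |x - y| ^ 4) :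
    ∃ G', IsContinuousModification G G' P := by
  have heven : Even (2 * p) := even_two_mul p
  have hp2 : 2 * p ≠ 0 := by omega
  have hc : 0 ≤ c := by
    have h1 := hmom 1 0 (by simp)
    have h2 : 0 ≤ ∫ ω, (G 1 ω - G 0 ω) ^ (2 * p) ∂P := integral_nonneg fun ω => heven.pow_nonneg _
    simpa using h2.trans h1
  have hhalf : ∀ n : ℕ, ((1 : ℝ) / 2) ^ n ≤ 1 := fun n => pow_le_one₀ (by norm_num) (by norm_num)
  have hpt : ∀ x, ∀ᵐ ω ∂P, Tendsto (fun n => G (dyadicFloor n x) ω) atTop (𝓝 (G x ω)) := by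
    intro x
    have hs : Summable fun n : ℕ => c * ((1 : ℝ) / 16) ^ n :=
      (summable_geometric_of_lt_one (by norm_num) (by norm_num)).mul_left c
    have := ae_summable_of_integral_le (P := P)
      (X := fun (n : ℕ) ω => (G (dyadicFloor n x) ω - G x ω) ^ (2 * p))
      (fun n ω => heven.pow_nonneg _) (fun n => hint _ _) hs (fun n => by
        have h1 := abs_dyadicFloor_sub_le n x
        refine (hmom _ _ (h1.trans (hhalf n))).trans ?_
        refine mul_le_mul_of_nonneg_left ?_ hc
        calc |dyadicFloor n x - x| ^ 4 ≤ ((1 / 2) ^ n) ^ 4 := by gcongr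
          _ = (1 / 16) ^ n := by rw [← pow_mul, mul_comm, pow_mul]; norm_num)
    filter_upwards [this] with ω hω
    have h0 := hω.tendsto_atTop_zero
    rw [← tendsto_sub_nhds_zero_iff, tendsto_zero_iff_abs_tendsto_zero]
    have h1 := h0.rpow_const (p := ((2 * p : ℕ) : ℝ)⁻¹) (Or.inr (by positivity))
    rw [Real.zero_rpow (by positivity)] at h1
    refine h1.congr fun n => ?_
    rw [← heven.pow_abs, Real.pow_rpow_inv_natCast (abs_nonneg _) hp2]
    rfl
  have hcont : ∀ᵐ ω ∂P, ∃ h : ℝ → ℝ, Continuous h ∧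
      ∀ x, Tendsto (fun n => G (dyadicFloor n x) ω) atTop (𝓝 (h x)) := by
    -- An increment at level `n` has moment at most `c / 16 ^ n`. The weight `8 ^ n` leaves `c / 2 ^
    -- n`, and `1 / (1 + k ^ 2)` makes the sum over all grid points of the line finite.
    have hs : Summable fun i : ℕ × ℤ => c * ((1 / 2 : ℝ) ^ i.1 * (1 / (1 + (i.2 : ℝ) ^ 2))) :=
      ((summable_geometric_of_lt_one (by norm_num) (by norm_num)).mul_of_nonneg
        summable_one_div_one_add_int_sq (fun n => by positivity) fun k => by positivity).mul_left c
    have := ae_summable_of_integral_le (P := P)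
      (X := fun (i : ℕ × ℤ) ω => 8 ^ i.1 / (1 + (i.2 : ℝ) ^ 2) *
        (G ((i.2 + 1) / 2 ^ i.1) ω - G (i.2 / 2 ^ i.1) ω) ^ (2 * p))
      (fun i ω => mul_nonneg (by positivity) (heven.pow_nonneg _))
      (fun i => (hint _ _).const_mul _) hs (fun i => by
        obtain ⟨n, k⟩ := i
        simp only
        have e : ((k : ℝ) + 1) / 2 ^ n - k / 2 ^ n = (1 / 2) ^ n := by
          rw [← sub_div, one_div, inv_pow]; simp
        have e' : |((k : ℝ) + 1) / 2 ^ n - k / 2 ^ n| = (1 / 2) ^ n := by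
          rw [e, abs_of_nonneg (by positivity)]
        have h1 := hmom ((k + 1) / 2 ^ n) (k / 2 ^ n) (by rw [e']; exact hhalf n)
        rw [e'] at h1
        rw [integral_const_mul]
        calc _ ≤ 8 ^ n / (1 + (k : ℝ) ^ 2) * (c * ((1 / 2) ^ n) ^ 4) := by gcongr
          _ = c * ((1 / 2 : ℝ) ^ n * (1 / (1 + (k : ℝ) ^ 2))) := by
            have : (8 : ℝ) ^ n * ((1 / 2) ^ n) ^ 4 = (1 / 2) ^ n := by
              rw [← pow_mul, mul_comm n 4, pow_mul, ← mul_pow]; norm_num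
            calc _ = c * ((8 ^ n * ((1 / 2) ^ n) ^ 4) * (1 / (1 + (k : ℝ) ^ 2))) := by ring
              _ = _ := by rw [this])
    filter_upwards [this] with ω hω
    set B : ℝ := ∑' i : ℕ × ℤ, 8 ^ i.1 / (1 + (i.2 : ℝ) ^ 2) *
        (G ((i.2 + 1) / 2 ^ i.1) ω - G (i.2 / 2 ^ i.1) ω) ^ (2 * p) with hB
    have hB0 : 0 ≤ B := tsum_nonneg fun i => mul_nonneg (by positivity) (heven.pow_nonneg _)
    have hle : ∀ (n : ℕ) (k : ℤ), 8 ^ n / (1 + (k : ℝ) ^ 2) *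
        (G ((k + 1) / 2 ^ n) ω - G (k / 2 ^ n) ω) ^ (2 * p) ≤ B := fun n k =>
      hω.le_tsum (n, k) fun i _ => mul_nonneg (by positivity) (heven.pow_nonneg _)
    have hrpow : ((1 / 2 : ℝ) ^ ((2 * p : ℕ) : ℝ)⁻¹) ^ (2 * p) = 1 / 2 :=
      Real.rpow_inv_natCast_pow (by norm_num) hp2
    -- For `|k| ≤ M * 2 ^ n` the weight `1 + k ^ 2` costs at most a factor `4 ^ n`, against the gain
    -- `8 ^ n`. The `2p`-th powers of the increments thus decay like `(1 / 2) ^ n`, and `r` is the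
    -- `2p`-th root of `1 / 2`.
    refine exists_continuous_tendsto_dyadicFloor (g := fun x => G x ω)
      (r := (1 / 2 : ℝ) ^ ((2 * p : ℕ) : ℝ)⁻¹) (by positivity)
      (Real.rpow_lt_one (by norm_num) (by norm_num) (by positivity)) fun M => ?_
    refine ⟨(B * (1 + (M : ℝ) ^ 2)) ^ ((2 * p : ℕ) : ℝ)⁻¹, by positivity, fun n k hk => ?_⟩
    rw [← pow_le_pow_iff_left₀ (abs_nonneg _) (by positivity) hp2, heven.pow_abs, mul_pow,
      Real.rpow_inv_natCast_pow (by positivity) hp2,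
      pow_right_comm ((1 / 2 : ℝ) ^ ((2 * p : ℕ) : ℝ)⁻¹) n, hrpow]
    have h1 := hle n k
    rw [div_mul_eq_mul_div, div_le_iff₀ (by positivity)] at h1
    have h2 : 1 + (k : ℝ) ^ 2 ≤ (1 + (M : ℝ) ^ 2) * 4 ^ n := by
      have h3 : (k : ℝ) ^ 2 ≤ (M * 2 ^ n) ^ 2 := by
        rw [← sq_abs]; gcongr
      have h4 : ((M : ℝ) * 2 ^ n) ^ 2 = (M : ℝ) ^ 2 * 4 ^ n := by
        rw [mul_pow, ← pow_mul, mul_comm n, pow_mul]; norm_num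
      have h5 : (1 : ℝ) ≤ 4 ^ n := one_le_pow₀ (by norm_num)
      linarith
    have h6 : (8 : ℝ) ^ n * (G ((k + 1) / 2 ^ n) ω - G (k / 2 ^ n) ω) ^ (2 * p) ≤
        8 ^ n * (B * (1 + (M : ℝ) ^ 2) * (1 / 2) ^ n) := by
      calc _ ≤ B * (1 + (k : ℝ) ^ 2) := h1
        _ ≤ B * ((1 + (M : ℝ) ^ 2) * 4 ^ n) := by gcongr
        _ = _ := by
          have : (4 : ℝ) ^ n = 8 ^ n * (1 / 2) ^ n := by rw [← mul_pow]; norm_num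
          rw [this]; ring
    exact le_of_mul_le_mul_left h6 (by positivity)
  -- The dyadic limit agrees with `G x` almost surely for each `x`, and is continuous in `x` on one
  -- event of full measure; elsewhere its value is irrelevant.
  refine ⟨fun x ω => limUnder atTop fun n => G (dyadicFloor n x) ω, fun x => ?_, ?_⟩
  · filter_upwards [hpt x] with ω hω using hω.limUnder_eq
  · filter_upwards [hcont] with ω ⟨h, hh, hlim⟩
    rwa [show (fun x => limUnder atTop fun n => G (dyadicFloor n x) ω) = h from
      funext fun x => (hlim x).limUnder_eq]

/-! ### Moments of centered Gaussian variables -/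

section Gaussian

variable {Ω : Type*} [MeasurableSpace Ω] {P : Measure Ω} {X : Ω → ℝ} {v : ℝ}

lemma map_eq_gaussianReal_of_integral_sq (hX : HasGaussianLaw X P) (hmean : ∫ ω, X ω ∂P = 0)
    (hv : ∫ ω, X ω ^ 2 ∂P = v) : P.map X = gaussianReal 0 v.toNNReal := by
  rw [hX.map_eq_gaussianReal, variance_of_integral_eq_zero hX.aemeasurable hmean, hmean, ← hv]

/-- Even moments of a centered Gaussian variable scale like powers of the variance. -/
lemma integral_pow_of_hasGaussianLaw (hX : HasGaussianLaw X P) (hmean : ∫ ω, X ω ∂P = 0)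
    (hv : ∫ ω, X ω ^ 2 ∂P = v) (p : ℕ) :
    Integrable (fun ω => X ω ^ (2 * p)) P ∧
      ∫ ω, X ω ^ (2 * p) ∂P = (∫ x, x ^ (2 * p) ∂gaussianReal 0 1) * v ^ p := by
  have hv0 : 0 ≤ v := hv ▸ integral_nonneg fun ω => sq_nonneg _
  have hmap := map_eq_gaussianReal_of_integral_sq hX hmean hv
  have hscale : gaussianReal 0 v.toNNReal = (gaussianReal 0 1).map (√v * ·) := by
    rw [gaussianReal_map_const_mul]
    congr 1
    · simp
    · ext
      simp [hv0, Real.sq_sqrt hv0]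
  constructor
  · have h1 : MemLp X (2 * p : ℕ) P := hX.memLp (ENNReal.natCast_ne_top _)
    rcases eq_or_ne (2 * p) 0 with h0 | h0
    · have := hX.isProbabilityMeasure
      simp [h0]
    · have := h1.integrable_norm_pow h0
      refine this.congr (Eventually.of_forall fun ω => ?_)
      simp only [Real.norm_eq_abs]
      exact (even_two_mul p).pow_abs _
  · have hmeas : AEStronglyMeasurable (fun x : ℝ => x ^ (2 * p)) (P.map X) := by fun_prop
    rw [← integral_map hX.aemeasurable hmeas, hmap, hscale, integral_map (by fun_prop)
      (by fun_prop)]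
    simp only [mul_pow]
    rw [integral_const_mul, pow_mul, Real.sq_sqrt hv0, mul_comm]

/-- Exponential moment of a centered Gaussian variable. -/
lemma integral_exp_neg_of_hasGaussianLaw (hX : HasGaussianLaw X P) (hmean : ∫ ω, X ω ∂P = 0)
    (hv : ∫ ω, X ω ^ 2 ∂P = v) :
    Integrable (fun ω => Real.exp (-X ω)) P ∧ ∫ ω, Real.exp (-X ω) ∂P = Real.exp (v / 2) := by
  have hv0 : 0 ≤ v := hv ▸ integral_nonneg fun ω => sq_nonneg _
  have hmap := map_eq_gaussianReal_of_integral_sq hX hmean hv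
  constructor
  · have h1 := integrable_exp_mul_gaussianReal (μ := 0) (v := v.toNNReal) (-1)
    rw [← hmap, integrable_map_measure (by fun_prop) hX.aemeasurable] at h1
    simpa [Function.comp_def] using h1
  · have h1 := mgf_gaussianReal hmap (-1)
    simpa [mgf, hv0] using h1

end Gaussian

/-! ### Second moments of the stationary field -/

section Stationary

variable {Ω : Type*} [MeasurableSpace Ω] {P : Measure Ω} {G : ℝ → Ω → ℝ} {C : ℝ → ℝ}

lemma integral_sub_sq_of_cov (hG : IsGaussianProcess G P)
    (hcov : ∀ x y, ∫ ω, G x ω * G y ω ∂P = C (x - y)) (x y : ℝ) :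
    ∫ ω, (G x ω - G y ω) ^ 2 ∂P = 2 * (C 0 - C (x - y)) := by
  have hi : ∀ x y, Integrable (fun ω => G x ω * G y ω) P := fun x y =>
    (hG.hasGaussianLaw_eval x).memLp_two.integrable_mul (hG.hasGaussianLaw_eval y).memLp_two
  have e : ∀ ω, (G x ω - G y ω) ^ 2 = G x ω * G x ω - 2 * (G x ω * G y ω) + G y ω * G y ω :=
    fun ω => by ring
  simp only [e]
  rw [integral_add ((hi x x).sub' ((hi x y).const_mul 2)) (hi y y),
    integral_sub (hi x x) ((hi x y).const_mul 2), integral_const_mul, hcov, hcov, hcov,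
    sub_self, sub_self]
  ring

/-- The product `exp (-G x) * exp (-G y)` is the exponential of a centered Gaussian variable with
this variance. -/
lemma integral_add_sq_of_cov (hG : IsGaussianProcess G P)
    (hcov : ∀ x y, ∫ ω, G x ω * G y ω ∂P = C (x - y)) (x y : ℝ) :
    ∫ ω, (G x ω + G y ω) ^ 2 ∂P = 2 * (C 0 + C (x - y)) := by
  have hi : ∀ x y, Integrable (fun ω => G x ω * G y ω) P := fun x y =>
    (hG.hasGaussianLaw_eval x).memLp_two.integrable_mul (hG.hasGaussianLaw_eval y).memLp_two
  have e : ∀ ω, (G x ω + G y ω) ^ 2 = G x ω * G x ω + 2 * (G x ω * G y ω) + G y ω * G y ω :=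
    fun ω => by ring
  simp only [e]
  rw [integral_add ((hi x x).fun_add ((hi x y).const_mul 2)) (hi y y),
    integral_add (hi x x) ((hi x y).const_mul 2), integral_const_mul, hcov, hcov, hcov,
    sub_self, sub_self]
  ring

/-- A centered stationary Gaussian field whose bounded covariance is Hölder continuous at `0` has
a modification with continuous sample paths. -/
lemma exists_isContinuousModification_of_holder (hG : IsGaussianProcess G P)
    (hmean : ∀ x, ∫ ω, G x ω ∂P = 0)
    (hcov : ∀ x y, ∫ ω, G x ω * G y ω ∂P = C (x - y))
    (hHolder : ∃ α : ℝ, 0 < α ∧ ∃ K : ℝ, ∀ᶠ x in 𝓝 (0 : ℝ), |C x - C 0| ≤ K * |x| ^ α)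
    (hbdd : ∃ K : ℝ, ∀ x, |C x| ≤ K) : ∃ G', IsContinuousModification G G' P := by
  obtain ⟨α, hα, K, hK⟩ := hHolder
  obtain ⟨B, hB⟩ := hbdd
  have hB0 : 0 ≤ B := (abs_nonneg _).trans (hB 0)
  obtain ⟨δ, hδ, hKδ⟩ := Metric.eventually_nhds_iff.1 hK
  -- Beyond distance `δ`, boundedness of `C` already gives a Hölder bound.
  have hglobal : ∀ x, |C x - C 0| ≤ (|K| + 2 * B / δ ^ α) * |x| ^ α := by
    intro x
    have h0 : 0 ≤ 2 * B / δ ^ α := by positivity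
    have hx0 : 0 ≤ |x| ^ α := by positivity
    rcases lt_or_ge |x| δ with h | h
    · refine (hKδ (by simpa using h)).trans ?_
      gcongr
      linarith [le_abs_self K]
    · have h1 : |C x - C 0| ≤ 2 * B := by
        have := abs_sub (C x) (C 0)
        linarith [hB x, hB 0]
      have h2 : δ ^ α ≤ |x| ^ α := by gcongr
      calc |C x - C 0| ≤ 2 * B := h1
        _ = 2 * B / δ ^ α * δ ^ α := by field_simp
        _ ≤ 2 * B / δ ^ α * |x| ^ α := by gcongr
        _ ≤ _ := by gcongr; linarith [abs_nonneg K]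
  -- The `2p`-th moment is of order `|x - y| ^ (α * p)`; Kolmogorov's criterion above asks for
  -- exponent `4`.
  obtain ⟨p, hp⟩ := exists_nat_ge (4 / α)
  have hpα : 4 ≤ α * p := by rwa [div_le_iff₀' hα] at hp
  have hp0 : p ≠ 0 := by rintro rfl; simp at hpα; linarith
  set L : ℝ := |K| + 2 * B / δ ^ α with hL
  have hL0 : 0 ≤ L := by positivity
  have hmom := fun x y => integral_pow_of_hasGaussianLaw (X := fun ω => G x ω - G y ω)
    hG.hasGaussianLaw_fun_sub (by
      rw [integral_sub (hG.hasGaussianLaw_eval x).integrable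
        (hG.hasGaussianLaw_eval y).integrable, hmean, hmean, sub_zero])
    (integral_sub_sq_of_cov hG hcov x y) p
  have hm0 : 0 ≤ ∫ x, x ^ (2 * p) ∂gaussianReal 0 1 :=
    integral_nonneg fun x => (even_two_mul p).pow_nonneg x
  refine exists_isContinuousModification hp0 (fun x y => (hmom x y).1)
    (c := (∫ x, x ^ (2 * p) ∂gaussianReal 0 1) * (2 * L) ^ p) fun x y hxy => ?_
  have hvar : 0 ≤ 2 * (C 0 - C (x - y)) :=
    integral_sub_sq_of_cov hG hcov x y ▸ integral_nonneg fun ω => sq_nonneg _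
  rw [(hmom x y).2, mul_assoc]
  refine mul_le_mul_of_nonneg_left ?_ hm0
  have h1 : 2 * (C 0 - C (x - y)) ≤ 2 * L * |x - y| ^ α := by
    have := hglobal (x - y)
    have := neg_abs_le (C (x - y) - C 0)
    linarith
  calc (2 * (C 0 - C (x - y))) ^ p ≤ (2 * L * |x - y| ^ α) ^ p := by gcongr
    _ = (2 * L) ^ p * |x - y| ^ (α * p) := by
      rw [mul_pow, Real.rpow_mul_natCast (abs_nonneg _)]
    _ ≤ (2 * L) ^ p * |x - y| ^ 4 := by
      refine mul_le_mul_of_nonneg_left ?_ (by positivity)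
      rcases (abs_nonneg (x - y)).eq_or_lt with h | h
      · rw [← h, Real.zero_rpow (by linarith)]; positivity
      · rw [← Real.rpow_natCast]
        exact Real.rpow_le_rpow_of_exponent_ge h hxy (by exact_mod_cast hpα)

/-- The field `exp (-G)` is integrable with mean `exp (C 0 / 2)`. -/
lemma integral_exp_neg_of_cov (hG : IsGaussianProcess G P)
    (hmean : ∀ x, ∫ ω, G x ω ∂P = 0)
    (hcov : ∀ x y, ∫ ω, G x ω * G y ω ∂P = C (x - y)) (x : ℝ) :
    Integrable (fun ω => Real.exp (-G x ω)) P ∧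
      ∫ ω, Real.exp (-G x ω) ∂P = Real.exp (C 0 / 2) :=
  integral_exp_neg_of_hasGaussianLaw (hG.hasGaussianLaw_eval x) (hmean x)
    (by simpa [sq] using hcov x x)

/-- Covariances of the field `exp (-G)`. -/
lemma integral_cov_exp_neg (hG : IsGaussianProcess G P)
    (hmean : ∀ x, ∫ ω, G x ω ∂P = 0)
    (hcov : ∀ x y, ∫ ω, G x ω * G y ω ∂P = C (x - y)) (x y : ℝ) :
    Integrable (fun ω => (Real.exp (-G x ω) - Real.exp (C 0 / 2)) *
        (Real.exp (-G y ω) - Real.exp (C 0 / 2))) P ∧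
      ∫ ω, (Real.exp (-G x ω) - Real.exp (C 0 / 2)) *
        (Real.exp (-G y ω) - Real.exp (C 0 / 2)) ∂P
        = Real.exp (C 0) * (Real.exp (C (x - y)) - 1) := by
  have := hG.isProbabilityMeasure
  obtain ⟨hx, hx'⟩ := integral_exp_neg_of_cov hG hmean hcov x
  obtain ⟨hy, hy'⟩ := integral_exp_neg_of_cov hG hmean hcov y
  obtain ⟨hxy, hxy'⟩ := integral_exp_neg_of_hasGaussianLaw (X := fun ω => G x ω + G y ω)
    hG.hasGaussianLaw_fun_add (by
      rw [integral_add (hG.hasGaussianLaw_eval x).integrable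
        (hG.hasGaussianLaw_eval y).integrable, hmean, hmean, add_zero])
    (integral_add_sq_of_cov hG hcov x y)
  set m := Real.exp (C 0 / 2) with hm
  have hmm : m * m = Real.exp (C 0) := by rw [hm, ← Real.exp_add]; congr 1; ring
  have e : ∀ ω, (Real.exp (-G x ω) - m) * (Real.exp (-G y ω) - m) =
      Real.exp (-(G x ω + G y ω)) - m * Real.exp (-G x ω) - m * Real.exp (-G y ω) + m * m := by
    intro ω
    rw [neg_add, Real.exp_add]; ring
  simp only [e]
  have i1 := hxy.sub' (hx.const_mul m)
  have i2 := i1.sub' (hy.const_mul m)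
  refine ⟨i2.add (integrable_const _), ?_⟩
  rw [integral_add i2 (integrable_const _), integral_sub i1 (hy.const_mul m),
    integral_sub hxy (hx.const_mul m), integral_const_mul, integral_const_mul, hxy', hx', hy',
    integral_const, hmm, mul_sub, ← Real.exp_add]
  simp

end Stationary

/-! ### Law of large numbers for fields with decaying correlations -/

/-- Riemann sums of a continuous function on `[0,1]` converge to its integral. -/
lemma tendsto_riemannSum {φ : ℝ → ℝ} (hφ : Continuous φ) :
    Tendsto (fun N : ℕ => (N : ℝ)⁻¹ * ∑ i ∈ Finset.range N, φ (i / N)) atTop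
      (𝓝 (∫ s in (0 : ℝ)..1, φ s)) := by
  rw [Metric.tendsto_atTop]
  intro e he
  obtain ⟨δ, hδ, hu⟩ := Metric.uniformContinuousOn_iff.1
    (isCompact_Icc.uniformContinuousOn_of_continuous (hφ.continuousOn (s := Set.Icc (0 : ℝ) 1)))
    (e / 2) (half_pos he)
  obtain ⟨N₀, hN₀⟩ := exists_nat_one_div_lt hδ
  refine ⟨N₀ + 1, fun N hN => ?_⟩
  have hN0 : (0 : ℝ) < N := by exact_mod_cast (Nat.succ_pos N₀).trans_le hN
  have hNδ : (N : ℝ)⁻¹ < δ := by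
    refine lt_of_le_of_lt ?_ hN₀
    rw [← one_div]
    exact one_div_le_one_div_of_le (by positivity) (by exact_mod_cast hN)
  have hlen : ∀ i : ℕ, ((i + 1 : ℕ) : ℝ) / N - i / N = (N : ℝ)⁻¹ := fun i => by
    push_cast; field_simp; ring
  have hsplit : ∫ s in (0 : ℝ)..1, φ s =
      ∑ i ∈ Finset.range N, ∫ s in ((i : ℕ) : ℝ) / N..((i + 1 : ℕ) : ℝ) / N, φ s := by
    rw [intervalIntegral.sum_integral_adjacent_intervals (a := fun i : ℕ => (i : ℝ) / N)
      fun k _ => hφ.intervalIntegrable _ _]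
    simp [hN0.ne']
  have hconst : ∀ i : ℕ, (N : ℝ)⁻¹ * φ (i / N) =
      ∫ s in (i : ℝ) / N..((i + 1 : ℕ) : ℝ) / N, φ (i / N) := fun i => by
    rw [intervalIntegral.integral_const, hlen, smul_eq_mul]
  rw [dist_eq_norm, hsplit, Finset.mul_sum, ← Finset.sum_sub_distrib]
  refine lt_of_le_of_lt (norm_sum_le_of_le _ (f := fun i : ℕ => (N : ℝ)⁻¹ * φ (i / N) -
    ∫ s in (i : ℝ) / N..((i + 1 : ℕ) : ℝ) / N, φ s) (n := fun _ => e / 2 * (N : ℝ)⁻¹) ?_) ?_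
  · intro i hi
    rw [hconst, ← intervalIntegral.integral_sub intervalIntegrable_const
      (hφ.intervalIntegrable _ _)]
    have hle : (i : ℝ) / N ≤ ((i + 1 : ℕ) : ℝ) / N := by
      have := hlen i
      have := inv_pos.2 hN0
      linarith
    have h1 : ((i + 1 : ℕ) : ℝ) / N ≤ 1 := by
      rw [div_le_one hN0]
      exact_mod_cast Finset.mem_range.1 hi
    have h0 : 0 ≤ (i : ℝ) / N := by positivity
    refine (intervalIntegral.norm_integral_le_of_norm_le_const (C := e / 2) fun s hs => ?_).trans
      (by rw [hlen, abs_of_pos (inv_pos.2 hN0)])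
    rw [Set.uIoc_of_le hle] at hs
    rw [← dist_eq_norm]
    refine (hu _ ⟨h0, hle.trans h1⟩ _ ⟨h0.trans hs.1.le, hs.2.trans h1⟩ ?_).le
    rw [dist_comm, Real.dist_eq, abs_of_pos (by linarith [hs.1])]
    have := hlen i
    linarith [hs.2]
  · rw [Finset.sum_const, Finset.card_range, nsmul_eq_mul]
    have : (N : ℝ) * (e / 2 * (N : ℝ)⁻¹) = e / 2 := by field_simp
    linarith

/-- Bounds the near-diagonal pairs in the double sum for the variance. -/
lemma card_filter_abs_sub_le (N i : ℕ) {r : ℝ} (hr : 0 ≤ r) :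
    ((Finset.range N).filter fun j : ℕ => |(i : ℝ) - j| ≤ r).card ≤ 2 * r + 1 := by
  have hsub : ((Finset.range N).filter fun j : ℕ => |(i : ℝ) - j| ≤ r).map
      Nat.castEmbedding ⊆ Finset.Icc ((i : ℤ) - ⌊r⌋) (i + ⌊r⌋) := by
    intro z hz
    simp only [Finset.mem_map, Finset.mem_filter, Nat.castEmbedding_apply] at hz
    obtain ⟨j, ⟨-, hj⟩, rfl⟩ := hz
    obtain ⟨h1, h2⟩ := abs_le.1 hj
    have h3 : (j : ℤ) - i ≤ ⌊r⌋ := Int.le_floor.2 (by push_cast; linarith)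
    have h4 : (i : ℤ) - j ≤ ⌊r⌋ := Int.le_floor.2 (by push_cast; linarith)
    rw [Finset.mem_Icc]
    constructor <;> omega
  have h := Finset.card_le_card hsub
  rw [Finset.card_map, Int.card_Icc] at h
  have hfl : 0 ≤ ⌊r⌋ := Int.floor_nonneg.2 hr
  have h' : (((Finset.range N).filter fun j : ℕ => |(i : ℝ) - j| ≤ r).card : ℤ) ≤ 2 * ⌊r⌋ + 1 := by
    omega
  have h'' : (((Finset.range N).filter fun j : ℕ => |(i : ℝ) - j| ≤ r).card : ℝ) ≤
      2 * ⌊r⌋ + 1 := by exact_mod_cast h'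
  linarith [Int.floor_le r]

section LargeNumbers

variable {Ω : Type*} [MeasurableSpace Ω] {P : Measure Ω} {Y : ℝ → Ω → ℝ} {L β : ℝ}

/-- Second moment of the Riemann sums of a field with decaying correlations. -/
lemma integral_sq_riemannSum_le (hint : ∀ x y, Integrable (fun ω => Y x ω * Y y ω) P)
    (hL : 0 ≤ L) (hβ : 0 < β)
    (hcov : ∀ x y, ∫ ω, Y x ω * Y y ω ∂P ≤ L * (1 + |x - y|) ^ (-β))
    {R δ : ℝ} (hR : 0 ≤ R) (hδ : 0 ≤ δ) {N : ℕ} (hN : N ≠ 0) :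
    Integrable (fun ω => ((N : ℝ)⁻¹ * ∑ i ∈ Finset.range N, Y (R * (i / N)) ω) ^ 2) P ∧
    ∫ ω, ((N : ℝ)⁻¹ * ∑ i ∈ Finset.range N, Y (R * (i / N)) ω) ^ 2 ∂P ≤
      L * (2 * δ + (N : ℝ)⁻¹ + (1 + R * δ) ^ (-β)) := by
  have hN0 : (0 : ℝ) < N := by positivity
  have e : ∀ ω, ((N : ℝ)⁻¹ * ∑ i ∈ Finset.range N, Y (R * (i / N)) ω) ^ 2 =
      (N : ℝ)⁻¹ ^ 2 * ∑ i ∈ Finset.range N, ∑ j ∈ Finset.range N,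
        Y (R * (i / N)) ω * Y (R * (j / N)) ω := fun ω => by
    rw [mul_pow, sq (∑ i ∈ Finset.range N, _), Finset.sum_mul_sum]
  simp only [e]
  have hi : ∀ i ∈ Finset.range N, Integrable (fun ω => ∑ j ∈ Finset.range N,
      Y (R * (i / N)) ω * Y (R * (j / N)) ω) P := fun i _ =>
    integrable_finsetSum _ fun j _ => hint _ _
  refine ⟨(integrable_finsetSum _ hi).const_mul _, ?_⟩
  rw [integral_const_mul, integral_finsetSum _ hi]
  have hq : 0 ≤ (1 + R * δ) ^ (-β) := by positivity
  -- Near the diagonal, covariances are bounded by `L`; other pairs are at distance at least `R *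
  -- δ`, where the decay applies.
  have hpair : ∀ i j : ℕ, ∫ ω, Y (R * (i / N)) ω * Y (R * (j / N)) ω ∂P ≤
      L * ((if |(i : ℝ) - j| ≤ δ * N then 1 else 0) + (1 + R * δ) ^ (-β)) := by
    intro i j
    refine (hcov _ _).trans (mul_le_mul_of_nonneg_left ?_ hL)
    split_ifs with h
    · have : (1 + |R * (i / N) - R * (j / N)|) ^ (-β) ≤ 1 :=
        Real.rpow_le_one_of_one_le_of_nonpos (by linarith [abs_nonneg (R * (i / N) - R * (j / N))])
          (by linarith)
      linarith
    · rw [zero_add]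
      refine Real.rpow_le_rpow_of_nonpos (by positivity) ?_ (by linarith)
      have h1 : |R * (i / N) - R * (j / N)| = R * (|(i : ℝ) - j| / N) := by
        rw [← mul_sub, ← sub_div, abs_mul, abs_div, abs_of_nonneg hR, abs_of_pos hN0]
      rw [h1]
      have h2 : δ ≤ |(i : ℝ) - j| / N := by
        rw [le_div_iff₀ hN0]; exact (not_le.1 h).le
      gcongr
  have hrow : ∀ i ∈ Finset.range N, ∫ ω, ∑ j ∈ Finset.range N,
      Y (R * (i / N)) ω * Y (R * (j / N)) ω ∂P ≤
        L * ((2 * (δ * N) + 1) + N * (1 + R * δ) ^ (-β)) := by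
    intro i _
    rw [integral_finsetSum _ fun j _ => hint _ _]
    refine (Finset.sum_le_sum fun j _ => hpair i j).trans ?_
    rw [← Finset.mul_sum, Finset.sum_add_distrib, Finset.sum_boole, Finset.sum_const,
      Finset.card_range, nsmul_eq_mul]
    refine mul_le_mul_of_nonneg_left ?_ hL
    have := card_filter_abs_sub_le N i (r := δ * N) (by positivity)
    linarith
  calc (N : ℝ)⁻¹ ^ 2 * ∑ i ∈ Finset.range N, ∫ ω, ∑ j ∈ Finset.range N,
        Y (R * (i / N)) ω * Y (R * (j / N)) ω ∂P
      ≤ (N : ℝ)⁻¹ ^ 2 * ∑ i ∈ Finset.range N,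
          L * ((2 * (δ * N) + 1) + N * (1 + R * δ) ^ (-β)) := by
        gcongr with i hi'
        exact hrow i hi'
    _ = L * (2 * δ + (N : ℝ)⁻¹ + (1 + R * δ) ^ (-β)) := by
        rw [Finset.sum_const, Finset.card_range, nsmul_eq_mul]
        field_simp

/-- Second moment of the spatial averages of a continuous field with decaying correlations. -/
lemma lintegral_sq_average_le (hY : ∀ x, AEMeasurable (Y x) P)
    (hint : ∀ x y, Integrable (fun ω => Y x ω * Y y ω) P)
    (hcont : ∀ᵐ ω ∂P, Continuous fun x => Y x ω) (hL : 0 ≤ L) (hβ : 0 < β)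
    (hcov : ∀ x y, ∫ ω, Y x ω * Y y ω ∂P ≤ L * (1 + |x - y|) ^ (-β))
    {R δ : ℝ} (hR : 0 ≤ R) (hδ : 0 ≤ δ) :
    AEMeasurable (fun ω => ∫ s in (0 : ℝ)..1, Y (R * s) ω) P ∧
    ∫⁻ ω, ENNReal.ofReal ((∫ s in (0 : ℝ)..1, Y (R * s) ω) ^ 2) ∂P ≤
      ENNReal.ofReal (L * (2 * δ + (1 + R * δ) ^ (-β))) := by
  set S : ℕ → Ω → ℝ := fun N ω => (N : ℝ)⁻¹ * ∑ i ∈ Finset.range N, Y (R * (i / N)) ω with hS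
  have hSm : ∀ N, AEMeasurable (S N) P := fun N => by
    rw [hS]
    exact (Finset.aemeasurable_fun_sum _ fun i _ => hY _).const_mul _
  have hlim : ∀ᵐ ω ∂P, Tendsto (fun N => S N ω) atTop (𝓝 (∫ s in (0 : ℝ)..1, Y (R * s) ω)) := by
    filter_upwards [hcont] with ω hω
    exact tendsto_riemannSum (φ := fun s => Y (R * s) ω) (hω.comp (continuous_const_mul R))
  refine ⟨aemeasurable_of_tendsto_metrizable_ae atTop hSm hlim, ?_⟩
  have hup : Tendsto (fun N : ℕ => ENNReal.ofReal (L * (2 * δ + (N : ℝ)⁻¹ + (1 + R * δ) ^ (-β))))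
      atTop (𝓝 (ENNReal.ofReal (L * (2 * δ + (1 + R * δ) ^ (-β))))) := by
    refine (ENNReal.continuous_ofReal.tendsto _).comp ?_
    have := (((tendsto_inv_atTop_nhds_zero_nat (𝕜 := ℝ)).const_add (2 * δ)).add_const
      ((1 + R * δ) ^ (-β))).const_mul L
    simpa using this
  -- Fatou's lemma passes the bound from Riemann sums to the integral, without joint measurability
  -- of the field.
  calc ∫⁻ ω, ENNReal.ofReal ((∫ s in (0 : ℝ)..1, Y (R * s) ω) ^ 2) ∂P
      = ∫⁻ ω, liminf (fun N => ENNReal.ofReal (S N ω ^ 2)) atTop ∂P := by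
        refine lintegral_congr_ae ?_
        filter_upwards [hlim] with ω hω
        exact (((ENNReal.continuous_ofReal.tendsto _).comp (hω.pow 2)).liminf_eq).symm
    _ ≤ liminf (fun N => ∫⁻ ω, ENNReal.ofReal (S N ω ^ 2) ∂P) atTop :=
        lintegral_liminf_le' fun N => ((hSm N).pow_const 2).ennreal_ofReal
    _ ≤ liminf (fun N : ℕ => ENNReal.ofReal (L * (2 * δ + (N : ℝ)⁻¹ + (1 + R * δ) ^ (-β))))
          atTop := by
        refine liminf_le_liminf ?_
        filter_upwards [eventually_ne_atTop 0] with N hN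
        obtain ⟨h1, h2⟩ := integral_sq_riemannSum_le hint hL hβ hcov hR hδ hN
        rw [← ofReal_integral_eq_lintegral_ofReal h1 (Eventually.of_forall fun ω => sq_nonneg _)]
        exact ENNReal.ofReal_le_ofReal h2
    _ = _ := hup.liminf_eq

/-- Spatial averages of a continuous field with decaying correlations vanish almost surely along
a sequence of powers. -/
lemma exists_ae_tendsto_average (hY : ∀ x, AEMeasurable (Y x) P)
    (hint : ∀ x y, Integrable (fun ω => Y x ω * Y y ω) P)
    (hcont : ∀ᵐ ω ∂P, Continuous fun x => Y x ω) (hL : 0 ≤ L) (hβ : 0 < β)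
    (hcov : ∀ x y, ∫ ω, Y x ω * Y y ω ∂P ≤ L * (1 + |x - y|) ^ (-β)) :
    ∃ k : ℕ, k ≠ 0 ∧ ∀ᵐ ω ∂P,
      Tendsto (fun n : ℕ => ∫ s in (0 : ℝ)..1, Y ((n : ℝ) ^ k * s) ω) atTop (𝓝 0) := by
  -- With `R = n ^ (2 * l)` and `δ = n ^ (-l)`, also `R * δ = n ^ l`. Both error terms are then
  -- summable once `l ≥ 2` and `β * l ≥ 2`.
  obtain ⟨l, hl⟩ := exists_nat_ge (max 2 (2 / β))
  have hl2 : 2 ≤ l := by exact_mod_cast (le_max_left _ _).trans hl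
  have hlβ : 2 ≤ β * l := by
    rw [← div_le_iff₀' hβ]; exact (le_max_right _ _).trans hl
  refine ⟨2 * l, by omega, ?_⟩
  have hav := fun n : ℕ => lintegral_sq_average_le hY hint hcont hL hβ hcov
    (R := (n : ℝ) ^ (2 * l)) (δ := ((n : ℝ) ^ l)⁻¹) (by positivity) (by positivity)
  have hs : Summable fun n : ℕ => L * (2 * ((n : ℝ) ^ l)⁻¹ +
      (1 + (n : ℝ) ^ (2 * l) * ((n : ℝ) ^ l)⁻¹) ^ (-β)) := by
    refine Summable.mul_left L (Summable.add ?_ ?_)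
    · exact (Real.summable_nat_pow_inv.2 (by omega)).mul_left 2
    · have h2 : Summable fun n : ℕ => ((n : ℝ) ^ 2)⁻¹ := Real.summable_nat_pow_inv.2 one_lt_two
      -- The comparison fails at `n = 0`, where the left term is `1` and the inverse square is `0`.
      rw [← summable_nat_add_iff 1] at h2 ⊢
      refine Summable.of_nonneg_of_le (fun n => by positivity) (fun n => ?_) h2
      have hn : (1 : ℝ) ≤ ((n + 1 : ℕ) : ℝ) := by exact_mod_cast Nat.succ_pos n
      set t : ℝ := ((n + 1 : ℕ) : ℝ) with ht
      have ht0 : 0 < t := by linarith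
      have e : t ^ (2 * l) * (t ^ l)⁻¹ = t ^ l := by
        rw [two_mul, pow_add]; field_simp
      rw [e]
      calc (1 + t ^ l) ^ (-β) ≤ (t ^ l) ^ (-β) :=
            Real.rpow_le_rpow_of_nonpos (by positivity) (by linarith) (by linarith)
        _ = t ^ (-(β * l)) := by
            rw [← Real.rpow_natCast, ← Real.rpow_mul ht0.le]; congr 1; ring
        _ ≤ t ^ (-(2 : ℝ)) := Real.rpow_le_rpow_of_exponent_le hn (by linarith)
        _ = (t ^ 2)⁻¹ := by rw [Real.rpow_neg ht0.le]; norm_cast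
  have := ae_summable_of_lintegral_le (P := P)
    (X := fun (n : ℕ) ω => (∫ s in (0 : ℝ)..1, Y ((n : ℝ) ^ (2 * l) * s) ω) ^ 2)
    (fun n ω => sq_nonneg _) (fun n => (hav n).1.pow_const 2) hs fun n => (hav n).2
  filter_upwards [this] with ω hω
  have h1 := hω.tendsto_atTop_zero.sqrt
  rw [Real.sqrt_zero] at h1
  rw [tendsto_zero_iff_abs_tendsto_zero]
  exact h1.congr fun n => Real.sqrt_sq_eq_abs _

end LargeNumbers

/-- **Ergodic theorem** for a nonnegative continuous field with decaying correlations. -/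
lemma ae_tendsto_integral_div {Ω : Type*} [MeasurableSpace Ω] {P : Measure Ω}
    {b : ℝ → Ω → ℝ} {m L β : ℝ} (hb0 : ∀ x ω, 0 ≤ b x ω) (hb : ∀ x, AEMeasurable (b x) P)
    (hint : ∀ x y, Integrable (fun ω => (b x ω - m) * (b y ω - m)) P)
    (hcont : ∀ᵐ ω ∂P, Continuous fun x => b x ω) (hL : 0 ≤ L) (hβ : 0 < β)
    (hcov : ∀ x y, ∫ ω, (b x ω - m) * (b y ω - m) ∂P ≤ L * (1 + |x - y|) ^ (-β)) :
    ∀ᵐ ω ∂P, Tendsto (fun R => (∫ y in (0 : ℝ)..R, b y ω) / R) atTop (𝓝 m) := by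
  obtain ⟨k, hk, h⟩ := exists_ae_tendsto_average (Y := fun x ω => b x ω - m)
    (fun x => (hb x).sub_const m) hint
    (by filter_upwards [hcont] with ω hω using hω.sub continuous_const) hL hβ hcov
  filter_upwards [h, hcont] with ω hω hc
  refine tendsto_div_atTop_of_tendsto_pow hk (A := fun R => ∫ y in (0 : ℝ)..R, b y ω) ?_
    (fun R hR => intervalIntegral.integral_nonneg hR fun y _ => hb0 y ω) ?_
  · intro x hx y hy hxy
    exact intervalIntegral.integral_mono_interval le_rfl hx hxy
      (Eventually.of_forall fun z => hb0 z ω) (hc.intervalIntegrable _ _)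
  · have h1 := hω.add_const m
    rw [zero_add] at h1
    refine h1.congr' ?_
    filter_upwards [eventually_ne_atTop 0] with n hn
    have hn0 : (n : ℝ) ^ k ≠ 0 := by positivity
    have hc' : Continuous fun s => b ((n : ℝ) ^ k * s) ω := hc.comp (continuous_const_mul _)
    rw [intervalIntegral.integral_sub (hc'.intervalIntegrable _ _) intervalIntegrable_const,
      intervalIntegral.integral_comp_mul_left (fun y => b y ω) hn0]
    simp [div_eq_inv_mul]

/-! ### Homogenization of the log-normal field -/

theorem theorem0 {Ω : Type*} [MeasurableSpace Ω] (P : Measure Ω) [IsProbabilityMeasure P]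
    (G : ℝ → Ω → ℝ) (C : ℝ → ℝ)
    (hG : IsGaussianProcess G P)
    (hmean : ∀ x, ∫ ω, G x ω ∂P = 0)
    (hcov : ∀ x y, ∫ ω, G x ω * G y ω ∂P = C (x - y))
    (hHolder : ∃ α : ℝ, 0 < α ∧ ∃ K : ℝ, ∀ᶠ x in 𝓝 (0 : ℝ), |C x - C 0| ≤ K * |x| ^ α)
    (β : ℝ) (hβ : 0 < β)
    (hdecay : ∃ K : ℝ, ∀ x : ℝ, |C x| ≤ K * (1 + |x|) ^ (-β))
    (f : ℝ → ℝ) (hf : ContDiffOn ℝ 1 f (Set.Icc 0 1)) :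
    (∃ G', IsContinuousModification G G' P) ∧
    ∀ G', IsContinuousModification G G' P →
      -- the effective coefficient
      (0 < aBar C ∧ ∀ x, Integrable (fun ω => 1 / logNormal G' x ω) P ∧
        (∫ ω, 1 / logNormal G' x ω ∂P)⁻¹ = aBar C) ∧
      -- the effective problem
      IsUniqueDirichletSolution (fun _ => aBar C) f (uBar (aBar C) f) ∧
      -- the heterogeneous problem, and almost sure pointwise convergence
      ∀ᵐ ω ∂P,
        (∀ ε > 0, IsUniqueDirichletSolution (fun x => logNormal G' (x / ε) ω) f
          (uEps (fun x => logNormal G' x ω) f ε)) ∧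
        ∀ x ∈ Set.Icc (0 : ℝ) 1,
          Tendsto (fun ε => uEps (fun z => logNormal G' z ω) f ε x) (𝓝[>] 0)
            (𝓝 (uBar (aBar C) f x)) := by
  obtain ⟨K, hK⟩ := hdecay
  have hK0 : 0 ≤ K := by simpa using (abs_nonneg _).trans (hK 0)
  have hpow1 : ∀ x : ℝ, (1 + |x|) ^ (-β) ≤ 1 := fun x =>
    Real.rpow_le_one_of_one_le_of_nonpos (by linarith [abs_nonneg x]) (by linarith)
  have hbdd : ∀ x, |C x| ≤ K := fun x =>
    (hK x).trans (mul_le_of_le_one_right hK0 (hpow1 x))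
  refine ⟨exists_isContinuousModification_of_holder hG hmean hcov hHolder ⟨K, hbdd⟩,
    fun G' hG' => ?_⟩
  -- A modification keeps the Gaussian property, mean and covariance, so everything below concerns
  -- `G'` alone.
  have hGauss : IsGaussianProcess G' P := hG.congr fun x => (hG'.modification x).symm
  have hmean' : ∀ x, ∫ ω, G' x ω ∂P = 0 := fun x =>
    (integral_congr_ae (hG'.modification x)).trans (hmean x)
  have hcov' : ∀ x y, ∫ ω, G' x ω * G' y ω ∂P = C (x - y) := fun x y =>
    (integral_congr_ae ((hG'.modification x).mul (hG'.modification y))).trans (hcov x y)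
  have hinv : ∀ x ω, 1 / logNormal G' x ω = Real.exp (-G' x ω) := fun x ω => by
    rw [logNormal, Real.exp_neg, one_div]
  have ha : 0 < aBar C := Real.exp_pos _
  have hainv : 1 / aBar C = Real.exp (C 0 / 2) := by
    rw [aBar, Real.exp_neg, one_div, inv_inv]
  refine ⟨⟨ha, fun x => ?_⟩, ?_, ?_⟩
  · simp only [hinv]
    obtain ⟨h1, h2⟩ := integral_exp_neg_of_cov hGauss hmean' hcov' x
    exact ⟨h1, by rw [h2, aBar, Real.exp_neg]⟩
  · rw [← uEps_const ha f 1]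
    exact isUniqueDirichletSolution_uEps (a := fun _ => aBar C) continuous_const (fun _ => ha) hf 1
  have hlln := ae_tendsto_integral_div (P := P) (b := fun x ω => Real.exp (-G' x ω))
    (m := Real.exp (C 0 / 2)) (L := Real.exp (C 0) * (K * Real.exp K)) (β := β)
    (fun x ω => (Real.exp_pos _).le)
    (fun x => (integral_exp_neg_of_cov hGauss hmean' hcov' x).1.aemeasurable)
    (fun x y => (integral_cov_exp_neg hGauss hmean' hcov' x y).1)
    (by filter_upwards [hG'.ae_continuous] with ω hω using Real.continuous_exp.comp hω.neg)
    (by positivity) hβ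
    (fun x y => by
      rw [(integral_cov_exp_neg hGauss hmean' hcov' x y).2, mul_assoc (Real.exp (C 0))]
      refine mul_le_mul_of_nonneg_left ?_ (Real.exp_pos _).le
      have hle : C (x - y) ≤ K * (1 + |x - y|) ^ (-β) := (le_abs_self _).trans (hK _)
      have hq : 0 ≤ K * (1 + |x - y|) ^ (-β) := by positivity
      set q := K * (1 + |x - y|) ^ (-β) with hqdef
      have hqK : q ≤ K := mul_le_of_le_one_right hK0 (hpow1 _)
      -- Gives `exp q - 1 ≤ q * exp q ≤ q * exp K`, so the covariance of `exp (-G')` inherits the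
      -- decay of `C`.
      have h1 : 1 - Real.exp (-q) ≤ q := by linarith [Real.add_one_le_exp (-q)]
      calc Real.exp (C (x - y)) - 1 ≤ Real.exp q - 1 := by gcongr
        _ = (1 - Real.exp (-q)) * Real.exp q := by
          rw [sub_mul, ← Real.exp_add]; simp
        _ ≤ q * Real.exp K := by gcongr
        _ = _ := by rw [hqdef]; ring)
  -- The exceptional set depends on neither `ε` nor `x`; from here on the argument is deterministic.
  filter_upwards [hlln, hG'.ae_continuous] with ω hω hc
  have hac : Continuous fun x => logNormal G' x ω := Real.continuous_exp.comp hc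
  have hapos : ∀ x, 0 < logNormal G' x ω := fun x => Real.exp_pos _
  refine ⟨fun ε _ => isUniqueDirichletSolution_uEps hac hapos hf ε, fun x hx => ?_⟩
  refine tendsto_uEps hac hapos ha ?_ hf hx
  simpa only [hinv, hainv] using hω
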